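/- **Setting.** Let $\mathcal{A}=(L_1,\dots,L_n)$ be an (ordered) arrangement of $n$ distinct lines in $\mathbb{CP}^2$. The multiplicity of a point $p\in\mathbb{CP}^2$ is the number of lines $L_i$ through $p$; $n_r$ denotes the number of points of multiplicity exactly $r$; a *multiple point* is a point of multiplicity at least $3$. The arrangement $\mathcal{A}$ is *non-reductive* if each line of $\mathcal{A}$ passes through at least $3$ multiple points. For $\mathcal{B}=(H_1,\dots,H_n)\in((\mathbb{CP}^2)^*)^n$ write $L(\mathcal{B})=L(\mathcal{A})$ if $\dim\bigcap_{i\in S}H_i=\dim\bigcap_{i\in S}L_i$ for every nonempty $S\subseteq\{1,\dots,n\}$. The moduli space of $\mathcal{A}$ is $$\mathcal{M}_{\mathcal{A}}=\{\mathcal{B}\in((\mathbb{CP}^2)^*)^n \mid L(\mathcal{B})=L(\mathcal{A})\}/PGL(3,\mathbb{C}),$$ with the quotient of the Zariski topology, and $\mathcal{M}^c_{\mathcal{A}}$ is the quotient of $\mathcal{M}_{\mathcal{A}}$ by complex conjugation. **Theorem.** Let $\mathcal{A}$ be a non-reductive arrangement of $10$ lines in $\mathbb{CP}^2$ such that $n_4=3$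 and $n_r=0$ for all $r\geq 5$. Then $\mathcal{M}_{\mathcal{A}}$ or $\mathcal{M}^c_{\mathcal{A}}$ is irreducible. -/

import Mathlib

open scoped LinearAlgebra.Projectivization Matrix

namespace LineArr

noncomputable section

/-- The complex projective plane. -/
abbrev Plane : Type := ℙ ℂ (Fin 3 → ℂ)

/-- The dual projective plane: `[a : b : c]` stands for the line `a x + b y + c z = 0`. -/
abbrev Line : Type := ℙ ℂ (Fin 3 → ℂ)

/-- The set of points of a line in the projective plane. -/
def points (L : Line) : Set Plane := {p | p.orthogonal L}

/-- The multiplicity of a point `p` in a family of lines: the number of its lines through `p`. -/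
def mult {n : ℕ} (A : Fin n → Line) (p : Plane) : ℕ := {i | p ∈ points (A i)}.ncard

/-- The number `n_r` of points of multiplicity exactly `r`. -/
def numPoints {n : ℕ} (A : Fin n → Line) (r : ℕ) : ℕ∞ := {p | mult A p = r}.encard

/-- Every line passes through at least three multiple points (points of multiplicity `≥ 3`). -/
def NonReductive {n : ℕ} (A : Fin n → Line) : Prop :=
  ∀ i, 3 ≤ {p | p ∈ points (A i) ∧ 3 ≤ mult A p}.encard

/-- The linear subspace of `ℂ³` whose projectivization is the intersection of the lines `A i`,
`i ∈ S`. -/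
def flat {n : ℕ} (A : Fin n → Line) (S : Finset (Fin n)) : Submodule ℂ (Fin 3 → ℂ) where
  carrier := {v | ∀ i ∈ S, v ⬝ᵥ (A i).rep = 0}
  zero_mem' := by simp
  add_mem' := by
    intro v w hv hw i hi
    rw [add_dotProduct, hv i hi, hw i hi, add_zero]
  smul_mem' := by
    intro c v hv i hi
    rw [smul_dotProduct, hv i hi, smul_zero]

/-- `L(A) = L(B)` as labelled lattices: the intersections of the lines labelled by `S` have the
same dimension in both families, for every nonempty set `S` of labels. -/
def SameLattice {n : ℕ} (A B : Fin n → Line) : Prop :=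
  ∀ S : Finset (Fin n), S.Nonempty → Module.finrank ℂ (flat A S) = Module.finrank ℂ (flat B S)

/-- The weight on the coordinates of `(ℂ³)ⁿ` that counts the degree in the `i`-th triple. -/
def blockWeight {n : ℕ} (i : Fin n) (q : Fin n × Fin 3) : ℕ := if q.1 = i then 1 else 0

/-- Polynomials in the coordinates of `(ℂ³)ⁿ` that are homogeneous in each triple separately. -/
def Multihomogeneous {n : ℕ} (F : MvPolynomial (Fin n × Fin 3) ℂ) : Prop :=
  ∀ i : Fin n, ∃ d : ℕ, F.IsWeightedHomogeneous (blockWeight i) d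

/-- The locus in `((ℂℙ²)*)ⁿ` where `F` does not vanish. -/
def nonvanishing {n : ℕ} (F : MvPolynomial (Fin n × Fin 3) ℂ) : Set (Fin n → Line) :=
  {B | MvPolynomial.eval (fun q => (B q.1).rep q.2) F ≠ 0}

/-- The Zariski topology of the product variety `((ℂℙ²)*)ⁿ`: the closed sets are the common zero
loci of families of multihomogeneous polynomials. -/
@[reducible] def zariski (n : ℕ) : TopologicalSpace (Fin n → Line) :=
  TopologicalSpace.generateFrom {U | ∃ F, Multihomogeneous F ∧ U = nonvanishing F}

/-- The set of all `B ∈ ((ℂℙ²)*)ⁿ` with `L(B) = L(A)`. -/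
def Realization {n : ℕ} (A : Fin n → Line) : Type := {B : Fin n → Line // SameLattice B A}

/-- The Zariski topology, as a subspace of `((ℂℙ²)*)ⁿ`. -/
instance {n : ℕ} (A : Fin n → Line) : TopologicalSpace (Realization A) :=
  TopologicalSpace.induced Subtype.val (zariski n)

/-- Two families of lines are projectively equivalent if some `g ∈ PGL(3, ℂ)` maps the `i`-th line
of the first to the `i`-th line of the second, for all `i`. -/
def projEquiv {n : ℕ} (A : Fin n → Line) : Setoid (Realization A) where
  r B C := ∃ g : Matrix.ProjGenLinGroup (Fin 3) ℂ,
    ∀ i, (fun p : Plane => g • p) '' points (B.1 i) = points (C.1 i)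
  iseqv :=
    { refl := fun B => ⟨1, fun i => by simp⟩
      symm := by
        rintro B C ⟨g, hg⟩
        refine ⟨g⁻¹, fun i => ?_⟩
        rw [← hg i, Set.image_image]
        simp
      trans := by
        rintro B C D ⟨g, hg⟩ ⟨h, hh⟩
        refine ⟨h * g, fun i => ?_⟩
        rw [← hh i, ← hg i, Set.image_image]
        simp [mul_smul] }

/-- The moduli space `M_A = {B ∈ ((ℂℙ²)*)ⁿ | L(B) = L(A)} / PGL(3, ℂ)`. -/
def Moduli {n : ℕ} (A : Fin n → Line) : Type := Quotient (projEquiv A)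

/-- The quotient of the Zariski topology. -/
instance {n : ℕ} (A : Fin n → Line) : TopologicalSpace (Moduli A) :=
  inferInstanceAs (TopologicalSpace (Quotient (projEquiv A)))

/-- Complex conjugation of all homogeneous coordinates, on points (and on lines). -/
def conj : ℙ ℂ (Fin 3 → ℂ) → ℙ ℂ (Fin 3 → ℂ) :=
  Projectivization.map (starLinearEquiv ℂ : (Fin 3 → ℂ) ≃ₗ⋆[ℂ] (Fin 3 → ℂ)).toLinearMap
    (starLinearEquiv ℂ : (Fin 3 → ℂ) ≃ₗ⋆[ℂ] (Fin 3 → ℂ)).injective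

theorem conj_mk (v : Fin 3 → ℂ) (hv : v ≠ 0) :
    conj (Projectivization.mk ℂ v hv) = Projectivization.mk ℂ (star v) (star_ne_zero.2 hv) := rfl

theorem conj_conj (p : ℙ ℂ (Fin 3 → ℂ)) : conj (conj p) = p := by
  induction p using Projectivization.ind with | h v hv => simp [conj_mk]

theorem conj_orthogonal (p L : ℙ ℂ (Fin 3 → ℂ)) :
    (conj p).orthogonal (conj L) ↔ p.orthogonal L := by
  induction p using Projectivization.ind with | h v hv =>
  induction L using Projectivization.ind with | h w hw =>
  rw [conj_mk, conj_mk, Projectivization.orthogonal_mk, Projectivization.orthogonal_mk,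
    Matrix.star_dotProduct_star, dotProduct_comm w v, star_eq_zero]

theorem mem_points_conj (p : Plane) (L : Line) : p ∈ points (conj L) ↔ conj p ∈ points L := by
  have h := conj_orthogonal (conj p) L
  rwa [conj_conj] at h

theorem exists_conj_smul (g : Matrix.ProjGenLinGroup (Fin 3) ℂ) :
    ∃ h : Matrix.ProjGenLinGroup (Fin 3) ℂ, ∀ p : Plane, conj (g • p) = h • conj p := by
  induction g using Matrix.ProjGenLinGroup.induction_on with | mk g =>
  refine ⟨.mk (Matrix.GeneralLinearGroup.map (starRingEnd ℂ) g), fun p => ?_⟩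
  induction p using Projectivization.ind with | h v hv =>
  rw [Projectivization.PGL.mk_smul_mk, conj_mk, conj_mk, Projectivization.PGL.mk_smul_mk]
  congr 1
  ext i
  simp [Units.smul_def, Matrix.mulVec, dotProduct]

theorem dotProduct_rep_eq_zero_iff (v : Fin 3 → ℂ) (w : Fin 3 → ℂ) (hw : w ≠ 0) :
    v ⬝ᵥ (Projectivization.mk ℂ w hw).rep = 0 ↔ v ⬝ᵥ w = 0 := by
  obtain ⟨a, ha⟩ := Projectivization.exists_smul_eq_mk_rep ℂ w hw
  rw [← ha, dotProduct_smul, smul_eq_zero_iff_eq]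

theorem star_mem_flat_conj {n : ℕ} (A : Fin n → Line) (S : Finset (Fin n)) (v : Fin 3 → ℂ) :
    star v ∈ flat (fun i => conj (A i)) S ↔ v ∈ flat A S := by
  refine forall₂_congr fun i _ => ?_
  show star v ⬝ᵥ (conj (A i)).rep = 0 ↔ v ⬝ᵥ (A i).rep = 0
  generalize A i = L
  induction L using Projectivization.ind with | h w hw =>
  rw [conj_mk, dotProduct_rep_eq_zero_iff, dotProduct_rep_eq_zero_iff,
    Matrix.star_dotProduct_star, dotProduct_comm w v, star_eq_zero]

theorem finrank_flat_conj {n : ℕ} (A : Fin n → Line) (S : Finset (Fin n)) :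
    Module.finrank ℂ (flat (fun i => conj (A i)) S) = Module.finrank ℂ (flat A S) := by
  let j : flat A S ≃+ flat (fun i => conj (A i)) S :=
    { toFun := fun v => ⟨star v.1, (star_mem_flat_conj A S v.1).2 v.2⟩
      invFun := fun v => ⟨star v.1, (star_mem_flat_conj A S _).1 (by rw [star_star]; exact v.2)⟩
      left_inv := fun v => by simp
      right_inv := fun v => by simp
      map_add' := fun v w => by ext; simp }
  have h := rank_eq_of_equiv_equiv (starRingEnd ℂ) j (starRingAut (R := ℂ)).bijective
    (fun r m => by ext; simp [j])
  exact (congrArg Cardinal.toNat h).symm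

/-- Complex conjugation on the space of realizations. -/
def Realization.conj {n : ℕ} {A : Fin n → Line} (B : Realization A) : Realization A :=
  ⟨fun i => LineArr.conj (B.1 i), fun S hS => (finrank_flat_conj B.1 S).trans (B.2 S hS)⟩

/-- Complex conjugation on the moduli space. -/
def Moduli.conj {n : ℕ} {A : Fin n → Line} : Moduli A → Moduli A :=
  Quotient.map Realization.conj (by
    rintro B C ⟨g, hg⟩
    obtain ⟨h, hh⟩ := exists_conj_smul g
    refine ⟨h, fun i => ?_⟩
    have key : ∀ L : Line, points (LineArr.conj L) = LineArr.conj '' points L := by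
      intro L
      ext p
      rw [mem_points_conj]
      exact ⟨fun hp => ⟨_, hp, conj_conj p⟩, by rintro ⟨q, hq, rfl⟩; rwa [conj_conj]⟩
    show (fun p : Plane => h • p) '' points (LineArr.conj (B.1 i)) = points (LineArr.conj (C.1 i))
    rw [key, key, ← hg i, Set.image_image, Set.image_image]
    simp only [hh])

/-- The quotient `M^c_A` of the moduli space by complex conjugation. -/
def ConjModuli {n : ℕ} (A : Fin n → Line) : Type := Quot fun x y : Moduli A => Moduli.conj x = y

instance {n : ℕ} (A : Fin n → Line) : TopologicalSpace (ConjModuli A) :=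
  inferInstanceAs (TopologicalSpace (Quot fun x y : Moduli A => Moduli.conj x = y))

end

end LineArr

/-!
Consider three quadruple points. If they lie on a common line `l`, then every line passes through
one of them, so a projective frame built from `l` and one further line through each of the three
points gives every realization coordinates `![f i, g i, h i]` in which only `h` varies. Two
realizations are joined by an affine line of choices of `h`, and almost all of its points are
realizations. Hence any two nonempty open sets of the moduli space meet.

Otherwise the three points are the vertices of a triangle whose sides belong to the arrangement, and
there is exactly one line `l` through none of them. Non-reductivity forces one of the two additional
lines through each vertex to pass through the intersection of `l` and the opposite side, and
normalizing the triangle and `l` leaves one parameter for the other line. The multiple points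
required on the additional lines force the three parameters to agree with a common value `-1`,
`I` or `-I`. The incidences tell `-1` from `±I`, and complex conjugation exchanges `I` and `-I`.
-/

namespace LineArr

open Projectivization Matrix Finset

section Lines

variable {K L M : Line} {p q : Plane}

theorem mk_mem_points_mk_iff {v w : Fin 3 → ℂ} (hv : v ≠ 0) (hw : w ≠ 0) :
    mk ℂ v hv ∈ points (mk ℂ w hw) ↔ v ⬝ᵥ w = 0 :=
  orthogonal_mk hv hw

theorem mk_mem_points_iff {v : Fin 3 → ℂ} (hv : v ≠ 0) :
    mk ℂ v hv ∈ points L ↔ v ⬝ᵥ L.rep = 0 := by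
  conv_lhs => rw [← L.mk_rep, mk_mem_points_mk_iff]

/-- Three lines are concurrent if they have a common point. -/
def Concurrent (K L M : Line) : Prop :=
  ∃ p : Plane, p ∈ points K ∧ p ∈ points L ∧ p ∈ points M

theorem concurrent_mk_iff {u v w : Fin 3 → ℂ} (hu : u ≠ 0) (hv : v ≠ 0) (hw : w ≠ 0) :
    Concurrent (mk ℂ u hu) (mk ℂ v hv) (mk ℂ w hw) ↔ det (of ![u, v, w]) = 0 := by
  rw [← exists_mulVec_eq_zero_iff]
  have mulVec_eq_zero_iff (z : Fin 3 → ℂ) :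
      of ![u, v, w] *ᵥ z = 0 ↔ z ⬝ᵥ u = 0 ∧ z ⬝ᵥ v = 0 ∧ z ⬝ᵥ w = 0 := by
    simp [funext_iff, Fin.forall_fin_succ, dotProduct_comm z]
  simp only [mulVec_eq_zero_iff]
  constructor
  · rintro ⟨p, hp⟩
    induction p using Projectivization.ind with | h z hz =>
    exact ⟨z, hz, by simpa only [mk_mem_points_mk_iff] using hp⟩
  · rintro ⟨z, hz, h⟩
    exact ⟨mk ℂ z hz, by simpa only [mk_mem_points_mk_iff] using h⟩

theorem Concurrent.rotate (h : Concurrent K L M) : Concurrent L M K := by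
  obtain ⟨p, hK, hL, hM⟩ := h
  exact ⟨p, hL, hM, hK⟩

theorem Concurrent.swap (h : Concurrent K L M) : Concurrent L K M := by
  obtain ⟨p, hK, hL, hM⟩ := h
  exact ⟨p, hL, hK, hM⟩

theorem concurrent_self_left (K L : Line) : Concurrent K K L := by
  induction K using Projectivization.ind with | h u hu =>
  induction L using Projectivization.ind with | h v hv =>
  exact (concurrent_mk_iff hu hu hv).2 (det_zero_of_row_eq (i := 0) (j := 1) (by decide) rfl)

theorem exists_mem_points (K L : Line) : ∃ p : Plane, p ∈ points K ∧ p ∈ points L :=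
  (concurrent_self_left K L).imp fun _ h => h.2

theorem eq_of_mem_points (h : K ≠ L) (hpK : p ∈ points K) (hpL : p ∈ points L)
    (hqK : q ∈ points K) (hqL : q ∈ points L) : p = q :=
  (Configuration.ofField.eq_or_eq_of_orthogonal hpK hqK hpL hqL).resolve_right h

theorem Concurrent.mem_points (h : Concurrent K L M) (hKL : K ≠ L) (hpK : p ∈ points K)
    (hpL : p ∈ points L) : p ∈ points M := by
  obtain ⟨q, hqK, hqL, hqM⟩ := h
  exact eq_of_mem_points hKL hpK hpL hqK hqL ▸ hqM

theorem exists_smul_mem_points_smul_iff (g : ProjGenLinGroup (Fin 3) ℂ) :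
    ∃ h : ProjGenLinGroup (Fin 3) ℂ,
      ∀ (p : Plane) (L : Line), h • p ∈ points (g • L) ↔ p ∈ points L := by
  induction g using ProjGenLinGroup.induction_on with | mk g =>
  have hdet : ((g⁻¹ : GL (Fin 3) ℂ) : Matrix (Fin 3) (Fin 3) ℂ)ᵀ.det ≠ 0 := by
    rw [det_transpose]
    exact (isUnits_det_units _).ne_zero
  refine ⟨.mk (GeneralLinearGroup.mkOfDetNeZero _ hdet), fun p L => ?_⟩
  induction p using Projectivization.ind with | h v hv =>
  induction L using Projectivization.ind with | h w hw =>
  rw [PGL.mk_smul_mk, PGL.mk_smul_mk, mk_mem_points_mk_iff, mk_mem_points_mk_iff]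
  have key : ((g⁻¹ : GL (Fin 3) ℂ) : Matrix (Fin 3) (Fin 3) ℂ)ᵀ *ᵥ v ⬝ᵥ g.1 *ᵥ w = v ⬝ᵥ w := by
    rw [mulVec_transpose, ← dotProduct_mulVec, mulVec_mulVec, ← Units.val_mul, inv_mul_cancel,
      Units.val_one, one_mulVec]
  exact Eq.congr_left key

theorem concurrent_smul_iff (g : ProjGenLinGroup (Fin 3) ℂ) :
    Concurrent (g • K) (g • L) (g • M) ↔ Concurrent K L M := by
  obtain ⟨h, hh⟩ := exists_smul_mem_points_smul_iff g
  exact (MulAction.surjective h).exists.trans (by simp only [hh, Concurrent])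

end Lines

section Flats

variable {n : ℕ} {A B : Fin n → Line} {S : Finset (Fin n)}

theorem finrank_flat_pos_iff :
    0 < Module.finrank ℂ (flat A S) ↔ ∃ p : Plane, ∀ i ∈ S, p ∈ points (A i) := by
  rw [Module.finrank_pos_iff_exists_ne_zero]
  constructor
  · rintro ⟨v, hv⟩
    exact ⟨mk ℂ v.1 (by simpa using hv), fun i hi => (mk_mem_points_iff _).2 (v.2 i hi)⟩
  · rintro ⟨p, hp⟩
    induction p using Projectivization.ind with | h v hv =>
    exact ⟨⟨v, fun i hi => (mk_mem_points_iff hv).1 (hp i hi)⟩, Subtype.coe_ne_coe.1 hv⟩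

theorem finrank_flat_le_one {i j : Fin n} (hi : i ∈ S) (hj : j ∈ S) (hij : A i ≠ A j) :
    Module.finrank ℂ (flat A S) ≤ 1 := by
  by_cases h : ∃ v : flat A S, v ≠ 0
  · obtain ⟨v, hv⟩ := h
    refine finrank_le_one v fun w => ?_
    by_cases hw : w = 0
    · exact ⟨0, by rw [hw, zero_smul]⟩
    have mem (u : flat A S) (hu : u.1 ≠ 0) {k : Fin n} (hk : k ∈ S) :
        mk ℂ u.1 hu ∈ points (A k) := (mk_mem_points_iff hu).2 (u.2 k hk)
    have hv' : v.1 ≠ 0 := by simpa using hv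
    have hw' : w.1 ≠ 0 := by simpa using hw
    obtain ⟨c, hc⟩ := (mk_eq_mk_iff' ℂ w.1 v.1 hw' hv').1
      (eq_of_mem_points hij (mem w hw' hi) (mem w hw' hj) (mem v hv' hi) (mem v hv' hj))
    exact ⟨c, Subtype.ext hc⟩
  · push Not at h
    have : Subsingleton (flat A S) := ⟨fun v w => (h v).trans (h w).symm⟩
    simp [Module.finrank_zero_of_subsingleton]

theorem finrank_flat_of_forall_eq {i : Fin n} (hi : i ∈ S) (h : ∀ j ∈ S, A j = A i) :
    Module.finrank ℂ (flat A S) = 2 := by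
  let f : Module.Dual ℂ (Fin 3 → ℂ) := dotProductBilin ℂ ℂ (A i).rep
  have hf : f ≠ 0 := fun h0 => (A i).rep_nonzero
    (dotProduct_eq_zero _ fun w => by simpa [f] using LinearMap.congr_fun h0 w)
  have hker : flat A S = LinearMap.ker f := by
    ext v
    change (∀ j ∈ S, v ⬝ᵥ (A j).rep = 0) ↔ (A i).rep ⬝ᵥ v = 0
    rw [dotProduct_comm]
    exact ⟨fun hv => hv i hi, fun hv j hj => by rw [h j hj, hv]⟩
  have := Module.Dual.finrank_ker_add_one_of_ne_zero hf
  rw [Module.finrank_fin_fun] at this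
  rw [hker]
  omega

theorem SameLattice.injective (h : SameLattice B A) (hA : Function.Injective A) :
    Function.Injective B := by
  intro i j hij
  by_contra hne
  have hB : Module.finrank ℂ (flat B {i, j}) = 2 :=
    finrank_flat_of_forall_eq (i := i) (by simp) (by simp [hij])
  have hA := finrank_flat_le_one (S := {i, j}) (by simp) (by simp) (hA.ne hne)
  have := h {i, j} (by simp)
  omega

theorem SameLattice.concurrent_iff (h : SameLattice B A) (i j k : Fin n) :
    Concurrent (B i) (B j) (B k) ↔ Concurrent (A i) (A j) (A k) := by
  have concurrent_iff_pos (C : Fin n → Line) :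
      Concurrent (C i) (C j) (C k) ↔ 0 < Module.finrank ℂ (flat C {i, j, k}) := by
    simp [finrank_flat_pos_iff, Concurrent]
  rw [concurrent_iff_pos, concurrent_iff_pos, h _ (by simp)]

theorem sameLattice_iff (hA : Function.Injective A) :
    SameLattice B A ↔ Function.Injective B ∧
      ∀ i j k, Concurrent (B i) (B j) (B k) ↔ Concurrent (A i) (A j) (A k) := by
  refine ⟨fun h => ⟨h.injective hA, h.concurrent_iff⟩, fun ⟨hB, h⟩ S hS => ?_⟩
  obtain ⟨i, rfl⟩ | ⟨i, hi, j, hj, hij⟩ := hS.exists_eq_singleton_or_nontrivial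
  · rw [finrank_flat_of_forall_eq (mem_singleton_self i) (by simp),
      finrank_flat_of_forall_eq (mem_singleton_self i) (by simp)]
  have exists_mem_iff {C : Fin n → Line} (hC : Function.Injective C) :
      (∃ p : Plane, ∀ k ∈ S, p ∈ points (C k)) ↔
        ∀ k ∈ S, Concurrent (C i) (C j) (C k) := by
    refine ⟨fun ⟨p, hp⟩ k hk => ⟨p, hp i hi, hp j hj, hp k hk⟩, fun hconc => ?_⟩
    obtain ⟨p, hpi, hpj⟩ := exists_mem_points (C i) (C j)
    exact ⟨p, fun k hk => (hconc k hk).mem_points (hC.ne hij) hpi hpj⟩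
  have hpos : 0 < Module.finrank ℂ (flat B S) ↔ 0 < Module.finrank ℂ (flat A S) := by
    rw [finrank_flat_pos_iff, finrank_flat_pos_iff, exists_mem_iff hA, exists_mem_iff hB]
    simp only [h]
  have := finrank_flat_le_one hi hj (hA.ne hij)
  have := finrank_flat_le_one hi hj (hB.ne hij)
  omega

end Flats

section Coordinates

variable {ι κ : Type*} {B : ι → Line} {s t : ι → Fin 3 → ℂ}

/-- In a suitable system of homogeneous coordinates of the plane, `s i` is a coordinate vector of
the line `B i` for every `i`. -/
def HasCoordinates (B : ι → Line) (s : ι → Fin 3 → ℂ) : Prop :=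
  ∃ g : ProjGenLinGroup (Fin 3) ℂ, ∀ i, ∃ hs : s i ≠ 0, B i = g • mk ℂ (s i) hs

theorem hasCoordinates_mk (hs : ∀ i, s i ≠ 0) : HasCoordinates (fun i => mk ℂ (s i) (hs i)) s :=
  ⟨1, fun i => ⟨hs i, (one_smul _ _).symm⟩⟩

namespace HasCoordinates

theorem ne_zero (h : HasCoordinates B s) (i : ι) : s i ≠ 0 := by
  obtain ⟨_, hg⟩ := h
  exact (hg i).1

theorem comp (h : HasCoordinates B s) (f : κ → ι) : HasCoordinates (B ∘ f) (s ∘ f) := by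
  obtain ⟨g, hg⟩ := h
  exact ⟨g, fun i => hg (f i)⟩

theorem eq_iff (h : HasCoordinates B s) (i j : ι) : B i = B j ↔ s i ⨯₃ s j = 0 := by
  obtain ⟨g, hg⟩ := h
  obtain ⟨hi, hBi⟩ := hg i
  obtain ⟨hj, hBj⟩ := hg j
  rw [hBi, hBj, smul_left_cancel_iff, mk_eq_mk_iff_crossProduct_eq_zero]

theorem concurrent_iff (h : HasCoordinates B s) (i j k : ι) :
    Concurrent (B i) (B j) (B k) ↔ det (of ![s i, s j, s k]) = 0 := by
  obtain ⟨g, hg⟩ := h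
  obtain ⟨hi, hBi⟩ := hg i
  obtain ⟨hj, hBj⟩ := hg j
  obtain ⟨hk, hBk⟩ := hg k
  rw [hBi, hBj, hBk, concurrent_smul_iff, concurrent_mk_iff]

theorem conj (h : HasCoordinates B s) :
    HasCoordinates (fun i => LineArr.conj (B i)) fun i => star (s i) := by
  obtain ⟨g, hg⟩ := h
  obtain ⟨g', hg'⟩ := exists_conj_smul g
  refine ⟨g', fun i => ?_⟩
  obtain ⟨hi, hBi⟩ := hg i
  exact ⟨star_ne_zero.2 hi, by simp only [hBi, hg', conj_mk]⟩

theorem of_mulVec_eq (h : HasCoordinates B s) (g : GL (Fin 3) ℂ) (hst : ∀ i, g.1 *ᵥ t i = s i) :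
    HasCoordinates B t := by
  obtain ⟨a, ha⟩ := h
  refine ⟨a * .mk g, fun i => ?_⟩
  obtain ⟨hs, hB⟩ := ha i
  have ht : t i ≠ 0 := fun h0 => hs (by rw [← hst i, h0, mulVec_zero])
  refine ⟨ht, ?_⟩
  rw [hB, mul_smul, PGL.mk_smul_mk]
  congr 2
  exact (hst i).symm

theorem projEquiv {n : ℕ} {A : Fin n → Line} {B C : Realization A} {s : Fin n → Fin 3 → ℂ}
    (hB : HasCoordinates B.1 s) (hC : HasCoordinates C.1 s) : projEquiv A B C := by
  obtain ⟨g, hg⟩ := hB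
  obtain ⟨g', hg'⟩ := hC
  obtain ⟨a, ha⟩ := exists_smul_mem_points_smul_iff (g' * g⁻¹)
  refine ⟨a, fun i => ?_⟩
  have hCB : C.1 i = (g' * g⁻¹) • B.1 i := by
    obtain ⟨_, hBi⟩ := hg i
    obtain ⟨_, hCi⟩ := hg' i
    rw [hBi, hCi, smul_smul, inv_mul_cancel_right]
  ext p
  obtain ⟨q, rfl⟩ := MulAction.surjective a p
  rw [(MulAction.injective a).mem_set_image, hCB, ha]

end HasCoordinates

end Coordinates

section Moduli

variable {n : ℕ} {s : Fin n → Fin 3 → ℂ}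

theorem nonempty_moduli (A : Fin n → Line) : Nonempty (Moduli A) :=
  ⟨Quotient.mk _ ⟨A, fun _ _ => rfl⟩⟩

theorem nonempty_conjModuli (A : Fin n → Line) : Nonempty (ConjModuli A) :=
  (nonempty_moduli A).map (Quot.mk _)

variable {A : Fin n → Line}

theorem subsingleton_moduli_of_hasCoordinates
    (h : ∀ B : Realization A, HasCoordinates B.1 s) : Subsingleton (Moduli A) where
  allEq x y := by
    induction x using Quotient.ind with | _ B
    induction y using Quotient.ind with | _ C
    exact Quotient.sound ((h B).projEquiv (h C))

theorem subsingleton_conjModuli_of_hasCoordinates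
    (h : ∀ B : Realization A, HasCoordinates B.1 s ∨ HasCoordinates B.1 fun i => star (s i)) :
    Subsingleton (ConjModuli A) := by
  have exists_eq_mk (x : ConjModuli A) :
      ∃ B : Realization A, HasCoordinates B.1 s ∧ x = Quot.mk _ (Quotient.mk (projEquiv A) B) := by
    induction x using Quot.ind with | _ x
    induction x using Quotient.ind with | _ B
    obtain hB | hB := h B
    · exact ⟨B, hB, rfl⟩
    · exact ⟨B.conj, (funext fun i => star_star (s i)) ▸ hB.conj, Quot.sound rfl⟩
  refine ⟨fun x y => ?_⟩
  obtain ⟨B, hB, rfl⟩ := exists_eq_mk x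
  obtain ⟨C, hC, rfl⟩ := exists_eq_mk y
  exact congrArg _ (Quotient.sound (hB.projEquiv hC))

end Moduli

section Curves

open Filter Topology Polynomial

theorem irreducibleSpace_of_forall_neBot_nhds_inf {X : Type*} [TopologicalSpace X] [Nonempty X]
    (h : ∀ x y : X, (𝓝 x ⊓ 𝓝 y).NeBot) : IrreducibleSpace X where
  isPreirreducible_univ := by
    rintro U V hU hV ⟨x, -, hx⟩ ⟨y, -, hy⟩
    obtain ⟨z, hz⟩ := (h x y).nonempty_of_mem (inter_mem_inf (hU.mem_nhds hx) (hV.mem_nhds hy))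
    exact ⟨z, Set.mem_univ z, hz⟩
  toNonempty := inferInstance

theorem Multihomogeneous.eval_eq_zero_iff_of_rescale {n : ℕ}
    {F : MvPolynomial (Fin n × Fin 3) ℂ} (hF : Multihomogeneous F) {x y : Fin n × Fin 3 → ℂ}
    {k : Fin n → ℂ} (hk : ∀ i, k i ≠ 0) (hxy : ∀ q, x q = k q.1 * y q) :
    MvPolynomial.eval x F = 0 ↔ MvPolynomial.eval y F = 0 := by
  choose d hd using hF
  have monomial_weight (m) (hm : m ∈ F.support) :
      ∏ q : Fin n × Fin 3, k q.1 ^ m q = ∏ i, k i ^ d i := by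
    rw [Fintype.prod_prod_type]
    refine prod_congr rfl fun i _ => ?_
    rw [prod_pow_eq_pow_sum univ (fun c => m (i, c)) (k i),
      ← hd i (MvPolynomial.mem_support_iff.1 hm), Finsupp.weight_apply,
      Finsupp.sum_fintype _ _ (by simp), Fintype.sum_prod_type]
    simp [blockWeight]
  have eval_rescale : MvPolynomial.eval x F = (∏ i, k i ^ d i) * MvPolynomial.eval y F := by
    rw [MvPolynomial.eval_eq', MvPolynomial.eval_eq', mul_sum]
    refine sum_congr rfl fun m hm => ?_
    simp only [hxy, mul_pow, prod_mul_distrib, monomial_weight m hm]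
    ring
  rw [eval_rescale, mul_eq_zero,
    or_iff_right (prod_ne_zero_iff.2 fun i _ => pow_ne_zero _ (hk i))]

theorem mk_mem_nonvanishing_iff {n : ℕ} {F : MvPolynomial (Fin n × Fin 3) ℂ}
    (hF : Multihomogeneous F) {s : Fin n → Fin 3 → ℂ} (hs : ∀ i, s i ≠ 0) :
    (fun i => mk ℂ (s i) (hs i)) ∈ nonvanishing F ↔
      MvPolynomial.eval (fun q => s q.1 q.2) F ≠ 0 := by
  choose k hk using fun i => exists_smul_eq_mk_rep ℂ (s i) (hs i)
  refine (hF.eval_eq_zero_iff_of_rescale (fun i => (k i).ne_zero) fun q => ?_).not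
  rw [← hk]
  rfl

theorem eventually_eval_ne_zero {R ι : Type*} [CommRing R] [IsDomain R] {v : ι → R[X]} {t₀ : R}
    (h : (fun c => (v c).eval t₀) ≠ 0) : ∀ᶠ t in cofinite, (fun c => (v c).eval t) ≠ 0 := by
  obtain ⟨c, hc⟩ := Function.ne_iff.1 h
  have hv : v c ≠ 0 := fun h0 => hc (by simp [h0])
  have hroots : ∀ᶠ t in cofinite, ¬ (v c).IsRoot t := by
    simpa using finite_setOfPred_isRoot hv
  filter_upwards [hroots] with t ht h0
  exact ht (congrFun h0 c)

variable {n : ℕ} {A : Fin n → Line} {p : Fin n → Fin 3 → ℂ[X]}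

/-- The values at `t` of a family of vectors of polynomials. -/
def evalAt (p : Fin n → Fin 3 → ℂ[X]) (t : ℂ) : Fin n → Fin 3 → ℂ := fun i c => (p i c).eval t

theorem tendsto_mk_evalAt {T : Set ℂ} (hT : ∀ t : T, ∀ i, evalAt p t i ≠ 0) (t₀ : T) :
    Tendsto (fun t : T => fun i => mk ℂ (evalAt p t i) (hT t i)) cofinite
      (@nhds _ (zariski n) fun i => mk ℂ (evalAt p t₀ i) (hT t₀ i)) := by
  rw [TopologicalSpace.tendsto_nhds_generateFrom_iff]
  rintro _ ⟨F, hF, rfl⟩ hmem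
  let P : ℂ[X] := MvPolynomial.aeval (fun q => p q.1 q.2) F
  have eval_P (t : ℂ) : P.eval t = MvPolynomial.eval (fun q => evalAt p t q.1 q.2) F := by
    simpa [P, evalAt, MvPolynomial.coe_aeval_eq_eval] using
      MvPolynomial.comp_aeval_apply (fun q : Fin n × Fin 3 => p q.1 q.2) (aeval t) F
  have hP₀ : (fun _ : Unit => P.eval t₀.1) ≠ 0 := by
    simpa [eval_P, funext_iff] using (mk_mem_nonvanishing_iff hF _).1 hmem
  filter_upwards [Subtype.val_injective.tendsto_cofinite.eventually (eventually_eval_ne_zero hP₀)]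
    with t ht
  exact (mk_mem_nonvanishing_iff hF _).2 fun h0 => ht (funext fun _ => (eval_P t).trans h0)

/-- The parameters at which the vectors `p i` are coordinates of a realization of `A`. -/
def realizingParams (A : Fin n → Line) (p : Fin n → Fin 3 → ℂ[X]) : Set ℂ :=
  {t | ∃ ht : ∀ i, evalAt p t i ≠ 0, SameLattice (fun i => mk ℂ (evalAt p t i) (ht i)) A}

/-- The algebraic curve of realizations of `A` with coordinates `p i`. -/
noncomputable def realizationCurve (A : Fin n → Line) (p : Fin n → Fin 3 → ℂ[X])
    (t : realizingParams A p) : Realization A :=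
  ⟨fun i => mk ℂ (evalAt p t i) (t.2.choose i), t.2.choose_spec⟩

theorem tendsto_realizationCurve (t₀ : realizingParams A p) :
    Tendsto (realizationCurve A p) cofinite (𝓝 (realizationCurve A p t₀)) := by
  let := zariski n
  rw [nhds_induced, tendsto_comap_iff]
  exact tendsto_mk_evalAt (fun t => t.2.choose) t₀

theorem hasCoordinates_realizationCurve (t : realizingParams A p) :
    HasCoordinates (realizationCurve A p t).1 (evalAt p t) :=
  hasCoordinates_mk t.2.choose

theorem HasCoordinates.mem_realizingParams (hA : Function.Injective A) {B : Realization A}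
    {t : ℂ} (h : HasCoordinates B.1 (evalAt p t)) : t ∈ realizingParams A p := by
  have h' := hasCoordinates_mk h.ne_zero
  refine ⟨h.ne_zero, (sameLattice_iff hA).2 ⟨fun i j hij => ?_, fun i j k => ?_⟩⟩
  · exact B.2.injective hA ((h.eq_iff i j).2 ((h'.eq_iff i j).1 hij))
  · rw [← B.2.concurrent_iff i j k, h.concurrent_iff]
    exact h'.concurrent_iff i j k

theorem tendsto_mk_realizationCurve (hA : Function.Injective A) {B : Realization A} {t₀ : ℂ}
    (h : HasCoordinates B.1 (evalAt p t₀)) :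
    Tendsto (fun t => (Quotient.mk (projEquiv A) (realizationCurve A p t) : Moduli A)) cofinite
      (𝓝 (Quotient.mk (projEquiv A) B : Moduli A)) := by
  let t₁ : realizingParams A p := ⟨t₀, h.mem_realizingParams hA⟩
  have hB : (Quotient.mk (projEquiv A) (realizationCurve A p t₁) : Moduli A) =
      Quotient.mk (projEquiv A) B :=
    Quotient.sound (HasCoordinates.projEquiv (hasCoordinates_realizationCurve t₁) h)
  have hcont : Continuous (Quotient.mk (projEquiv A) : Realization A → Moduli A) :=
    continuous_quot_mk
  rw [← hB]
  exact hcont.continuousAt.tendsto.comp (tendsto_realizationCurve t₁)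

theorem eventually_mem_realizingParams (hA : Function.Injective A) {B : Realization A} {t₀ : ℂ}
    (h : HasCoordinates B.1 (evalAt p t₀))
    (hconc : ∀ i j k, Concurrent (A i) (A j) (A k) → det (of ![p i, p j, p k]) = 0) :
    ∀ᶠ t in cofinite, t ∈ realizingParams A p := by
  have eval_cross (t : ℂ) (i j : Fin n) :
      (fun c => ((p i ⨯₃ p j) c).eval t) = evalAt p t i ⨯₃ evalAt p t j := by
    ext c
    fin_cases c <;> simp [cross_apply, evalAt]
  have eval_det (t : ℂ) (i j k : Fin n) : (det (of ![p i, p j, p k])).eval t =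
      det (of ![evalAt p t i, evalAt p t j, evalAt p t k]) := by
    simp [det_fin_three, evalAt]
  have hne : ∀ᶠ t in cofinite, ∀ i, evalAt p t i ≠ 0 :=
    eventually_all.2 fun i => eventually_eval_ne_zero (h.ne_zero i)
  have hcross : ∀ᶠ t in cofinite, ∀ i j, i ≠ j → evalAt p t i ⨯₃ evalAt p t j ≠ 0 := by
    simp only [eventually_all, ← eval_cross]
    intro i j hij
    refine eventually_eval_ne_zero (t₀ := t₀) ?_
    rw [eval_cross]
    exact (h.eq_iff i j).not.1 ((B.2.injective hA).ne hij)
  have hdet : ∀ᶠ t in cofinite, ∀ i j k,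
      det (of ![evalAt p t i, evalAt p t j, evalAt p t k]) = 0 ↔
        Concurrent (A i) (A j) (A k) := by
    simp only [eventually_all, ← eval_det]
    intro i j k
    by_cases hijk : Concurrent (A i) (A j) (A k)
    · exact .of_forall fun t => by simp [hconc i j k hijk, hijk]
    have h₀ : (fun _ : Unit => (det (of ![p i, p j, p k])).eval t₀) ≠ 0 := by
      simpa [funext_iff, eval_det, ← h.concurrent_iff, B.2.concurrent_iff] using hijk
    filter_upwards [eventually_eval_ne_zero h₀] with t ht
    simpa [funext_iff, hijk] using ht
  filter_upwards [hne, hcross, hdet] with t hne hcross hdet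
  have h' := hasCoordinates_mk hne
  refine ⟨hne, (sameLattice_iff hA).2 ⟨fun i j hij => ?_, fun i j k => ?_⟩⟩
  · by_contra hij'
    exact hcross i j hij' ((h'.eq_iff i j).1 hij)
  · exact (h'.concurrent_iff i j k).trans (hdet i j k)

theorem irreducibleSpace_moduli_of_hasCoordinates (hA : Function.Injective A) (f g : Fin n → ℂ)
    (hcoord : ∀ B : Realization A, ∃ h : Fin n → ℂ, HasCoordinates B.1 fun i => ![f i, g i, h i]) :
    IrreducibleSpace (Moduli A) := by
  have := nonempty_moduli A
  refine irreducibleSpace_of_forall_neBot_nhds_inf fun x y => ?_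
  induction x using Quotient.ind with | _ B
  induction y using Quotient.ind with | _ B₁
  obtain ⟨h, hB⟩ := hcoord B
  obtain ⟨h', hB'⟩ := hcoord B₁
  -- Determinants with two fixed columns are affine in the third one, so the concurrences of `A`
  -- persist along the line from `h` to `h'`.
  let p (i : Fin n) : Fin 3 → ℂ[X] := ![C (f i), C (g i), C (h i) + X * C (h' i - h i)]
  have evalAt_p (t : ℂ) :
      evalAt p t = fun i => ![f i, g i, h i + t * (h' i - h i)] := by
    ext i c
    fin_cases c <;> simp [evalAt, p]
  have hB₀ : HasCoordinates B.1 (evalAt p 0) := by simpa [evalAt_p] using hB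
  have hB₁ : HasCoordinates B₁.1 (evalAt p 1) := by simpa [evalAt_p] using hB'
  have hconc (i j k : Fin n) (hijk : Concurrent (A i) (A j) (A k)) :
      det (of ![p i, p j, p k]) = 0 := by
    have h₀ := (hB.concurrent_iff i j k).1 ((B.2.concurrent_iff i j k).2 hijk)
    have h₁ := (hB'.concurrent_iff i j k).1 ((B₁.2.concurrent_iff i j k).2 hijk)
    have det_p : det (of ![p i, p j, p k]) =
        (1 - X) * C (det (of ![![f i, g i, h i], ![f j, g j, h j], ![f k, g k, h k]])) +
          X * C (det (of ![![f i, g i, h' i], ![f j, g j, h' j], ![f k, g k, h' k]])) := by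
      simp only [det_fin_three, p, of_apply, Matrix.cons_val, map_add, map_sub, map_mul]
      ring
    rw [det_p, h₀, h₁]
    simp
  have : Infinite (realizingParams A p) := Set.Infinite.to_subtype <|
    frequently_cofinite_mem_iff_infinite.1
      (eventually_mem_realizingParams hA hB₀ hconc).frequently
  exact map_neBot.mono
    (le_inf (tendsto_mk_realizationCurve hA hB₀) (tendsto_mk_realizationCurve hA hB₁))

end Curves

section Frames

variable {K L M N : Line}

theorem exists_eq_smul_add_smul_add_smul {F : Type*} [Field F] {u v w : Fin 3 → F}
    (h : det (of ![u, v, w]) ≠ 0) (x : Fin 3 → F) : ∃ a b c : F, x = a • u + b • v + c • w := by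
  obtain ⟨y, hy⟩ := vecMul_surjective_iff_isUnit.2
    ((isUnit_iff_isUnit_det _).2 (isUnit_iff_ne_zero.2 h)) x
  exact ⟨y 0, y 1, y 2, by rw [← hy]; exact (vecMul_eq_sum _ _).trans (Fin.sum_univ_three _)⟩

theorem exists_eq_smul_add_smul {u v : Fin 3 → ℂ} {hu : u ≠ 0} {hv : v ≠ 0}
    {g : ProjGenLinGroup (Fin 3) ℂ} (hK : K = g • mk ℂ u hu) (hL : L = g • mk ℂ v hv)
    (hKL : K ≠ L) (h : Concurrent K L M) (hML : M ≠ L) :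
    ∃ (a : ℂ) (ha : u + a • v ≠ 0), M = g • mk ℂ (u + a • v) ha := by
  obtain ⟨M, rfl⟩ := MulAction.surjective g M
  subst hK hL
  rw [concurrent_smul_iff] at h
  rw [Ne, smul_left_cancel_iff] at hKL hML
  induction M using Projectivization.ind with | h w hw =>
  have hind : LinearIndependent ℂ ![u, v] :=
    (independent_mk_iff_LinearIndependent hu hv).1 ((independent_pair_iff_ne _ _).2 hKL)
  have hdep : ¬ LinearIndependent ℂ ![w, u, v] := fun hi =>
    ((isUnit_iff_isUnit_det _).1 (linearIndependent_rows_iff_isUnit.1 hi)).ne_zero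
      ((concurrent_mk_iff hw hu hv).1 h.rotate.rotate)
  obtain ⟨b, a, rfl⟩ : ∃ b a : ℂ, b • u + a • v = w := by
    have := mt (linearIndependent_finCons.2 ⟨hind, ·⟩) hdep
    rwa [not_not, range_cons_cons_empty, Submodule.mem_span_pair] at this
  have hb : b ≠ 0 := by
    rintro rfl
    exact hML ((mk_eq_mk_iff' ℂ _ _ _ _).2 ⟨a, by simp⟩)
  have hw' : b • u + a • v = b • (u + (b⁻¹ * a) • v) := by
    rw [smul_add, smul_smul, mul_inv_cancel_left₀ hb]
  exact ⟨b⁻¹ * a, right_ne_zero_of_smul (hw' ▸ hw),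
    congrArg _ ((mk_eq_mk_iff' ℂ _ _ _ _).2 ⟨b, hw'.symm⟩)⟩

theorem exists_eq_smul_frame (hKLM : ¬ Concurrent K L M) (hNLM : ¬ Concurrent N L M)
    (hKNM : ¬ Concurrent K N M) : ∃ (g : ProjGenLinGroup (Fin 3) ℂ) (z : ℂ),
      K = g • mk ℂ ![1, 0, 0] (by simp) ∧ L = g • mk ℂ ![0, 1, 0] (by simp) ∧
      M = g • mk ℂ ![0, 0, 1] (by simp) ∧ N = g • mk ℂ ![1, 1, z] (by simp) := by
  induction K using Projectivization.ind with | h u hu =>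
  induction L using Projectivization.ind with | h v hv =>
  induction M using Projectivization.ind with | h w hw =>
  induction N using Projectivization.ind with | h x hx =>
  rw [concurrent_mk_iff] at hKLM hNLM hKNM
  obtain ⟨a, b, z, rfl⟩ := exists_eq_smul_add_smul_add_smul hKLM x
  have ha : a ≠ 0 := by
    rintro rfl
    refine hNLM ?_
    simp only [det_fin_three, of_apply, Matrix.cons_val, Pi.add_apply, Pi.smul_apply, smul_eq_mul]
    ring
  have hb : b ≠ 0 := by
    rintro rfl
    refine hKNM ?_
    simp only [det_fin_three, of_apply, Matrix.cons_val, Pi.add_apply, Pi.smul_apply, smul_eq_mul]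
    ring
  have hdet : (of ![a • u, b • v, w])ᵀ.det ≠ 0 := by
    have : (of ![a • u, b • v, w]).det = a * b * (of ![u, v, w]).det := by
      simp only [det_fin_three, of_apply, Matrix.cons_val, Pi.smul_apply, smul_eq_mul]
      ring
    rw [det_transpose, this]
    exact mul_ne_zero (mul_ne_zero ha hb) hKLM
  have hmul (y : Fin 3 → ℂ) :
      (of ![a • u, b • v, w])ᵀ *ᵥ y = y 0 • a • u + y 1 • b • v + y 2 • w := by
    rw [mulVec_transpose, vecMul_eq_sum, Fin.sum_univ_three]
    rfl
  refine ⟨.mk (GeneralLinearGroup.mkOfDetNeZero _ hdet), z, ?_, ?_, ?_, ?_⟩ <;>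
    rw [PGL.mk_smul_mk, eq_comm, mk_eq_mk_iff']
  · exact ⟨a, (by simp : a • u = _).trans (hmul _).symm⟩
  · exact ⟨b, (by simp : b • v = _).trans (hmul _).symm⟩
  · exact ⟨1, (by simp : (1 : ℂ) • w = _).trans (hmul _).symm⟩
  · exact ⟨1, (one_smul ℂ _).trans ((by simp : _ = _).trans (hmul _).symm)⟩

theorem exists_eq_smul_projective_frame (hKLM : ¬ Concurrent K L M) (hNLM : ¬ Concurrent N L M)
    (hKNM : ¬ Concurrent K N M) (hKLN : ¬ Concurrent K L N) :
    ∃ g : ProjGenLinGroup (Fin 3) ℂ,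
      K = g • mk ℂ ![1, 0, 0] (by simp) ∧ L = g • mk ℂ ![0, 1, 0] (by simp) ∧
      M = g • mk ℂ ![0, 0, 1] (by simp) ∧ N = g • mk ℂ ![1, 1, 1] (by simp) := by
  obtain ⟨g, z, rfl, rfl, rfl, rfl⟩ := exists_eq_smul_frame hKLM hNLM hKNM
  have hz : z ≠ 0 := by
    rintro rfl
    rw [concurrent_smul_iff, concurrent_mk_iff] at hKLN
    exact hKLN (by simp [det_fin_three])
  have hdet : (diagonal ![1, 1, z]).det ≠ 0 := by simpa [Fin.prod_univ_three] using hz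
  refine ⟨g * .mk (GeneralLinearGroup.mkOfDetNeZero _ hdet), ?_, ?_, ?_, ?_⟩ <;>
    rw [mul_smul, smul_left_cancel_iff, PGL.mk_smul_mk, eq_comm, mk_eq_mk_iff'] <;>
    [use 1; use 1; use z; use 1] <;>
    ext i <;> fin_cases i <;>
    simp [Units.smul_def, GeneralLinearGroup.mkOfDetNeZero, mulVec_diagonal]

end Frames

section CollinearCenters

variable {n : ℕ} {A : Fin n → Line}

theorem irreducibleSpace_moduli_of_collinear (hA : Function.Injective A) {l a b c : Fin n}
    (hab : ¬ Concurrent (A a) (A b) (A l)) (hbc : ¬ Concurrent (A c) (A b) (A l))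
    (hac : ¬ Concurrent (A a) (A c) (A l))
    (hall : ∀ i, Concurrent (A a) (A l) (A i) ∨ Concurrent (A b) (A l) (A i) ∨
      Concurrent (A c) (A l) (A i)) :
    IrreducibleSpace (Moduli A) := by
  have coords (i : Fin n) : ∃ f g : ℂ, ∀ (B : Realization A) (γ : ProjGenLinGroup (Fin 3) ℂ) (z),
      B.1 a = γ • mk ℂ ![1, 0, 0] (by simp) → B.1 b = γ • mk ℂ ![0, 1, 0] (by simp) →
      B.1 l = γ • mk ℂ ![0, 0, 1] (by simp) → B.1 c = γ • mk ℂ ![1, 1, z] (by simp) →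
      ∃ (h : ℂ) (hs : ![f, g, h] ≠ 0), B.1 i = γ • mk ℂ ![f, g, h] hs := by
    obtain rfl | hil := eq_or_ne i l
    · exact ⟨0, 0, fun B γ z _ _ hl _ => ⟨1, _, hl⟩⟩
    have pencil {B : Realization A} {γ : ProjGenLinGroup (Fin 3) ℂ} {d : Fin n} {x y z : ℂ}
        {hu : ![x, y, z] ≠ 0} (hd : Concurrent (A d) (A l) (A i)) (hdl : d ≠ l)
        (hBd : B.1 d = γ • mk ℂ ![x, y, z] hu) (hBl : B.1 l = γ • mk ℂ ![0, 0, 1] (by simp)) :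
        ∃ (h : ℂ) (hs : ![x, y, h] ≠ 0), B.1 i = γ • mk ℂ ![x, y, h] hs := by
      have hinj := B.2.injective hA
      obtain ⟨h, hs, hBi⟩ := exists_eq_smul_add_smul hBd hBl (hinj.ne hdl)
        ((B.2.concurrent_iff _ _ _).2 hd) (hinj.ne hil)
      exact ⟨z + h, by simpa using hs, by simpa using hBi⟩
    have ne_l {d e : Fin n} (h : ¬ Concurrent (A d) (A e) (A l)) : d ≠ l := by
      rintro rfl
      exact h (concurrent_self_left _ _).rotate
    rcases hall i with hi | hi | hi
    · exact ⟨1, 0, fun B γ z ha _ hl _ => pencil hi (ne_l hab) ha hl⟩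
    · exact ⟨0, 1, fun B γ z _ hb hl _ => pencil hi (ne_l (mt .swap hab)) hb hl⟩
    · exact ⟨1, 1, fun B γ z _ _ hl hc => pencil hi (ne_l hbc) hc hl⟩
  choose f g hfg using coords
  refine irreducibleSpace_moduli_of_hasCoordinates hA f g fun B => ?_
  simp only [← B.2.concurrent_iff] at hab hbc hac
  obtain ⟨γ, z, ha, hb, hl, hc⟩ := exists_eq_smul_frame hab hbc hac
  choose h hs hB using fun i => hfg i B γ z ha hb hl hc
  exact ⟨h, γ, fun i => ⟨hs i, hB i⟩⟩

end CollinearCenters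

section Incidence

variable {n : ℕ} {A : Fin n → Line} {P Q : Plane} {i j : Fin n}

open Classical in
/-- The lines of the family through a point, given by their indices. -/
noncomputable def through (A : Fin n → Line) (p : Plane) : Finset (Fin n) :=
  univ.filter fun i => p ∈ points (A i)

theorem mem_through : i ∈ through A P ↔ P ∈ points (A i) := by
  simp [through]

theorem card_through (A : Fin n → Line) (p : Plane) : (through A p).card = mult A p := by
  rw [mult, ← Set.ncard_coe_finset]
  simp [through]

theorem eq_of_mem_through (hA : Function.Injective A) (hPQ : P ≠ Q) (hiP : i ∈ through A P)
    (hiQ : i ∈ through A Q) (hjP : j ∈ through A P) (hjQ : j ∈ through A Q) : i = j := by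
  rw [mem_through] at hiP hiQ hjP hjQ
  by_contra hij
  exact hPQ (eq_of_mem_points (hA.ne hij) hiP hjP hiQ hjQ)

theorem card_through_inter_le_one (hA : Function.Injective A) (hPQ : P ≠ Q) :
    (through A P ∩ through A Q).card ≤ 1 := by
  simp only [card_le_one, mem_inter]
  exact fun i hi j hj => eq_of_mem_through hA hPQ hi.1 hi.2 hj.1 hj.2

theorem through_inter_eq_singleton (hA : Function.Injective A) (hPQ : P ≠ Q)
    (hP : i ∈ through A P) (hQ : i ∈ through A Q) : through A P ∩ through A Q = {i} :=
  eq_singleton_iff_unique_mem.2 ⟨mem_inter.2 ⟨hP, hQ⟩, fun _ hj =>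
    eq_of_mem_through hA hPQ (mem_inter.1 hj).1 (mem_inter.1 hj).2 hP hQ⟩

theorem concurrent_of_mem_through {k : Fin n} (hi : i ∈ through A P) (hj : j ∈ through A P)
    (hk : k ∈ through A P) : Concurrent (A i) (A j) (A k) :=
  ⟨P, mem_through.1 hi, mem_through.1 hj, mem_through.1 hk⟩

theorem mem_through_of_concurrent (hA : Function.Injective A) {k : Fin n} (hij : i ≠ j)
    (hi : i ∈ through A P) (hj : j ∈ through A P) (h : Concurrent (A i) (A j) (A k)) :
    k ∈ through A P :=
  mem_through.2 (h.mem_points (hA.ne hij) (mem_through.1 hi) (mem_through.1 hj))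

theorem card_union_three {α : Type*} [DecidableEq α] (s t u : Finset α) :
    (s ∪ t ∪ u).card + (s ∩ t).card + (s ∩ u).card + (t ∩ u).card =
      s.card + t.card + u.card + (s ∩ t ∩ u).card := by
  have h₁ := card_union_add_card_inter s t
  have h₂ := card_union_add_card_inter (s ∪ t) u
  have h₃ := card_union_add_card_inter (s ∩ u) (t ∩ u)
  rw [← union_inter_distrib_right, ← inter_inter_distrib_right] at h₃
  omega

end Incidence

section ThirdPoints

variable {n : ℕ} {A B : Fin n → Line}

theorem NonReductive.exists_third_point (h : NonReductive A) (i : Fin n) (P Q : Plane) :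
    ∃ x y, x ≠ i ∧ y ≠ i ∧ x ≠ y ∧ ∃ Z, Z ≠ P ∧ Z ≠ Q ∧
      i ∈ through A Z ∧ x ∈ through A Z ∧ y ∈ through A Z := by
  obtain ⟨Z, ⟨hZi, hZ⟩, hZPQ⟩ : ∃ Z, (Z ∈ points (A i) ∧ 3 ≤ mult A Z) ∧ Z ∉ ({P, Q} : Set _) := by
    refine Set.not_subset.1 fun hsub => ?_
    have := (h i).trans ((Set.encard_le_encard hsub).trans (Set.encard_insert_le _ _))
    rw [Set.encard_singleton] at this
    exact absurd this (by decide)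
  rw [← mem_through] at hZi
  obtain ⟨x, hx, y, hy, hxy⟩ : ∃ x ∈ (through A Z).erase i, ∃ y ∈ (through A Z).erase i, x ≠ y := by
    rw [← one_lt_card, card_erase_of_mem hZi, card_through]
    omega
  rw [mem_erase] at hx hy
  simp only [Set.mem_insert_iff, Set.mem_singleton_iff, not_or] at hZPQ
  exact ⟨x, y, hx.1, hy.1, hxy, Z, hZPQ.1, hZPQ.2, hZi, hx.2, hy.2⟩

/-- Every line `B i` carries, besides its intersections with any two other lines, a point that
lies on at least two further lines. For an injective family this is non-reductivity, expressed
through concurrency alone. -/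
def HasThirdPoints {ι : Type*} (B : ι → Line) : Prop :=
  ∀ i j k, j ≠ i → k ≠ i → ∃ x y, x ≠ y ∧ Concurrent (B i) (B x) (B y) ∧
    ¬ Concurrent (B i) (B j) (B x) ∧ ¬ Concurrent (B i) (B j) (B y) ∧
    ¬ Concurrent (B i) (B k) (B x) ∧ ¬ Concurrent (B i) (B k) (B y)

theorem NonReductive.hasThirdPoints (h : NonReductive A) (hA : Function.Injective A) :
    HasThirdPoints A := by
  intro i j k hji hki
  obtain ⟨P, hPi, hPj⟩ := exists_mem_points (A i) (A j)
  obtain ⟨Q, hQi, hQk⟩ := exists_mem_points (A i) (A k)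
  obtain ⟨x, y, hx, hy, hxy, Z, hZP, hZQ, hiZ, hxZ, hyZ⟩ := h.exists_third_point i P Q
  rw [← mem_through] at hPi hPj hQi hQk
  have not_concurrent {z m : Fin n} {X : Plane} (hZX : Z ≠ X) (hzi : z ≠ i) (hmi : m ≠ i)
      (hz : z ∈ through A Z) (hi : i ∈ through A X) (hm : m ∈ through A X) :
      ¬ Concurrent (A i) (A m) (A z) := fun hc =>
    hzi (eq_of_mem_through hA hZX hz (mem_through_of_concurrent hA hmi.symm hi hm hc) hiZ hi)
  exact ⟨x, y, hxy, concurrent_of_mem_through hiZ hxZ hyZ,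
    not_concurrent hZP hx hji hxZ hPi hPj, not_concurrent hZP hy hji hyZ hPi hPj,
    not_concurrent hZQ hx hki hxZ hQi hQk, not_concurrent hZQ hy hki hyZ hQi hQk⟩

theorem HasThirdPoints.comp {ι κ : Type*} {B : ι → Line} (h : HasThirdPoints B) (e : κ ≃ ι) :
    HasThirdPoints (B ∘ e) := by
  intro i j k hji hki
  obtain ⟨x, y, hxy, hconc⟩ := h (e i) (e j) (e k) (e.injective.ne hji) (e.injective.ne hki)
  exact ⟨e.symm x, e.symm y, e.symm.injective.ne hxy, by simpa using hconc⟩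

theorem SameLattice.hasThirdPoints (h : SameLattice B A) (hA : HasThirdPoints A) :
    HasThirdPoints B := by
  simpa only [HasThirdPoints, h.concurrent_iff] using hA

end ThirdPoints

section QuadruplePoints

variable {A : Fin 10 → Line} {P Q R : Plane}

theorem irreducibleSpace_moduli_of_common_line (hA : Function.Injective A)
    (hP : mult A P = 4) (hQ : mult A Q = 4) (hR : mult A R = 4) (hPQ : P ≠ Q)
    (hPR : P ≠ R) (hQR : Q ≠ R) {l : Fin 10} (hlP : l ∈ through A P) (hlQ : l ∈ through A Q)
    (hlR : l ∈ through A R) : IrreducibleSpace (Moduli A) := by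
  have cover : through A P ∪ through A Q ∪ through A R = univ := by
    have := card_union_three (through A P) (through A Q) (through A R)
    rw [through_inter_eq_singleton hA hPQ hlP hlQ, through_inter_eq_singleton hA hPR hlP hlR,
      through_inter_eq_singleton hA hQR hlQ hlR, singleton_inter_of_mem hlR] at this
    simp only [card_through, card_singleton, hP, hQ, hR] at this
    rw [← card_eq_iff_eq_univ, Fintype.card_fin]
    omega
  have exists_mem_ne_l (X : Plane) (hX : mult A X = 4) : ∃ a ∈ through A X, a ≠ l :=
    exists_mem_ne (by rw [card_through, hX]; norm_num) l
  obtain ⟨a, haP, hal⟩ := exists_mem_ne_l P hP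
  obtain ⟨b, hbQ, hbl⟩ := exists_mem_ne_l Q hQ
  obtain ⟨c, hcR, hcl⟩ := exists_mem_ne_l R hR
  have not_concurrent {X Y : Plane} {i j : Fin 10} (hXY : X ≠ Y) (hi : i ∈ through A X)
      (hlX : l ∈ through A X) (hj : j ∈ through A Y) (hlY : l ∈ through A Y) (hil : i ≠ l)
      (hjl : j ≠ l) : ¬ Concurrent (A i) (A j) (A l) := fun h =>
    hjl (eq_of_mem_through hA hXY
      (mem_through_of_concurrent hA hil.symm hlX hi h.rotate.rotate) hj hlX hlY)
  refine irreducibleSpace_moduli_of_collinear hA (not_concurrent hPQ haP hlP hbQ hlQ hal hbl)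
    (not_concurrent hQR.symm hcR hlR hbQ hlQ hcl hbl)
    (not_concurrent hPR haP hlP hcR hlR hal hcl) fun i => ?_
  have hi : i ∈ through A P ∪ through A Q ∪ through A R := cover ▸ mem_univ i
  rw [mem_union, mem_union, or_assoc] at hi
  exact hi.imp (concurrent_of_mem_through haP hlP)
    (.imp (concurrent_of_mem_through hbQ hlQ) (concurrent_of_mem_through hcR hlR))

end QuadruplePoints

section Triangle

variable {A : Fin 10 → Line} {P Q R : Plane} {u v w l : Fin 10}

theorem exists_mem_through_inter (hA : Function.Injective A) (hnr : NonReductive A)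
    (hP : mult A P = 4) (hQ : mult A Q = 4) (hR : mult A R = 4) (hPQ : P ≠ Q) (hPR : P ≠ R)
    (hno : ∀ i ∈ through A P, i ∈ through A Q → i ∉ through A R) :
    ∃ u ∈ through A Q, u ∈ through A R := by
  by_contra! hQR
  have hQR_card : (through A Q ∩ through A R).card = 0 := by
    simpa [eq_empty_iff_forall_notMem] using hQR
  have hcard := card_union_three (through A P) (through A Q) (through A R)
  have hle := card_le_univ (through A P ∪ through A Q ∪ through A R)
  have hPQ_card := card_through_inter_le_one hA hPQ
  have hPR_card := card_through_inter_le_one hA hPR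
  simp only [card_through, Fintype.card_fin] at hcard hle
  obtain ⟨w, hw⟩ : (through A P ∩ through A Q).Nonempty := by
    rw [← card_pos]
    omega
  have cover : through A P ∪ through A Q ∪ through A R = univ := by
    rw [← card_eq_iff_eq_univ, Fintype.card_fin]
    omega
  obtain ⟨hwP, hwQ⟩ := mem_inter.1 hw
  obtain ⟨x, y, hxw, hyw, hxy, Z, hZP, hZQ, hwZ, hxZ, hyZ⟩ := hnr.exists_third_point w P Q
  have mem_through_R {z : Fin 10} (hzw : z ≠ w) (hz : z ∈ through A Z) : z ∈ through A R := by
    have : z ∈ through A P ∪ through A Q ∪ through A R := cover ▸ mem_univ z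
    rw [mem_union, mem_union] at this
    exact this.resolve_left (not_or.2
      ⟨fun h => hzw (eq_of_mem_through hA hZP hz h hwZ hwP),
        fun h => hzw (eq_of_mem_through hA hZQ hz h hwZ hwQ)⟩)
  exact hno w hwP hwQ (mem_through_of_concurrent hA hxy (mem_through_R hxw hxZ)
    (mem_through_R hyw hyZ) (concurrent_of_mem_through hxZ hyZ hwZ))

/-- Three quadruple points `P`, `Q`, `R` among ten lines that form a triangle with sides
`u = QR`, `v = RP`, `w = PQ`, together with the only line `l` that passes through none of them. -/
structure IsQuadrupleTriangle (A : Fin 10 → Line) (P Q R : Plane) (u v w l : Fin 10) : Prop where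
  mult_P : mult A P = 4
  mult_Q : mult A Q = 4
  mult_R : mult A R = 4
  u_notMem : u ∉ through A P
  u_mem_Q : u ∈ through A Q
  u_mem_R : u ∈ through A R
  v_mem_P : v ∈ through A P
  v_notMem : v ∉ through A Q
  v_mem_R : v ∈ through A R
  w_mem_P : w ∈ through A P
  w_mem_Q : w ∈ through A Q
  w_notMem : w ∉ through A R
  eq_l_iff : ∀ i, i = l ↔ i ∉ through A P ∧ i ∉ through A Q ∧ i ∉ through A R

theorem exists_isQuadrupleTriangle (hA : Function.Injective A) (hnr : NonReductive A)
    (hP : mult A P = 4) (hQ : mult A Q = 4) (hR : mult A R = 4) (hPQ : P ≠ Q) (hPR : P ≠ R)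
    (hQR : Q ≠ R) (hno : ∀ i ∈ through A P, i ∈ through A Q → i ∉ through A R) :
    ∃ u v w l, IsQuadrupleTriangle A P Q R u v w l := by
  obtain ⟨u, huQ, huR⟩ := exists_mem_through_inter hA hnr hP hQ hR hPQ hPR hno
  obtain ⟨v, hvP, hvR⟩ := exists_mem_through_inter hA hnr hQ hP hR hPQ.symm hQR
    fun i hiQ hiP => hno i hiP hiQ
  obtain ⟨w, hwP, hwQ⟩ := exists_mem_through_inter hA hnr hR hP hQ hPR.symm hQR.symm
    fun i hiR hiP hiQ => hno i hiP hiQ hiR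
  have hwR := hno w hwP hwQ
  obtain ⟨l, hl⟩ : ∃ l, (through A P ∪ through A Q ∪ through A R)ᶜ = {l} := by
    have := card_union_three (through A P) (through A Q) (through A R)
    rw [through_inter_eq_singleton hA hPQ hwP hwQ, through_inter_eq_singleton hA hPR hvP hvR,
      through_inter_eq_singleton hA hQR huQ huR, singleton_inter_of_notMem hwR] at this
    simp only [card_through, card_singleton, card_empty, hP, hQ, hR] at this
    rw [← card_eq_one, card_compl, Fintype.card_fin]
    omega
  refine ⟨u, v, w, l, hP, hQ, hR, fun h => hno u h huQ huR, huQ, huR, hvP,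
    fun h => hno v hvP h hvR, hvR, hwP, hwQ, hwR, fun i => ?_⟩
  rw [← mem_singleton, ← hl, mem_compl, mem_union, mem_union, not_or, not_or, and_assoc]

namespace IsQuadrupleTriangle

theorem rotate (h : IsQuadrupleTriangle A P Q R u v w l) :
    IsQuadrupleTriangle A Q R P v w u l where
  mult_P := h.mult_Q
  mult_Q := h.mult_R
  mult_R := h.mult_P
  u_notMem := h.v_notMem
  u_mem_Q := h.v_mem_R
  u_mem_R := h.v_mem_P
  v_mem_P := h.w_mem_Q
  v_notMem := h.w_notMem
  v_mem_R := h.w_mem_P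
  w_mem_P := h.u_mem_Q
  w_mem_Q := h.u_mem_R
  w_notMem := h.u_notMem
  eq_l_iff i := (h.eq_l_iff i).trans (by tauto)

theorem u_ne_v (h : IsQuadrupleTriangle A P Q R u v w l) : u ≠ v :=
  ne_of_mem_of_not_mem h.u_mem_Q h.v_notMem

theorem exists_concurrent (h : IsQuadrupleTriangle A P Q R u v w l) (hA : Function.Injective A)
    (hnr : NonReductive A) :
    ∃ p ∈ through A P, p ≠ v ∧ p ≠ w ∧ Concurrent (A u) (A l) (A p) := by
  obtain ⟨x, y, hxu, hyu, hxy, Z, hZQ, hZR, huZ, hxZ, hyZ⟩ := hnr.exists_third_point u Q R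
  have notMem_Q {z : Fin 10} (hz : z ∈ through A Z) (hzu : z ≠ u) : z ∉ through A Q :=
    fun hzQ => hzu (eq_of_mem_through hA hZQ hz hzQ huZ h.u_mem_Q)
  have notMem_R {z : Fin 10} (hz : z ∈ through A Z) (hzu : z ≠ u) : z ∉ through A R :=
    fun hzR => hzu (eq_of_mem_through hA hZR hz hzR huZ h.u_mem_R)
  have eq_l {z : Fin 10} (hz : z ∈ through A Z) (hzu : z ≠ u) (hzP : z ∉ through A P) : z = l :=
    (h.eq_l_iff z).2 ⟨hzP, notMem_Q hz hzu, notMem_R hz hzu⟩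
  have of_mem_P {p : Fin 10} (hpZ : p ∈ through A Z) (hpu : p ≠ u) (hlZ : l ∈ through A Z)
      (hpP : p ∈ through A P) : ∃ p ∈ through A P, p ≠ v ∧ p ≠ w ∧ Concurrent (A u) (A l) (A p) :=
    ⟨p, hpP, (ne_of_mem_of_not_mem h.v_mem_R (notMem_R hpZ hpu)).symm,
      (ne_of_mem_of_not_mem h.w_mem_Q (notMem_Q hpZ hpu)).symm,
      concurrent_of_mem_through huZ hlZ hpZ⟩
  by_cases hxP : x ∈ through A P <;> by_cases hyP : y ∈ through A P
  · exact absurd (mem_through_of_concurrent hA hxy hxP hyP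
      (concurrent_of_mem_through hxZ hyZ huZ)) h.u_notMem
  · exact of_mem_P hxZ hxu (eq_l hyZ hyu hyP ▸ hyZ) hxP
  · exact of_mem_P hyZ hyu (eq_l hxZ hxu hxP ▸ hxZ) hyP
  · exact absurd ((eq_l hxZ hxu hxP).trans (eq_l hyZ hyu hyP).symm) hxy

theorem exists_through_eq (h : IsQuadrupleTriangle A P Q R u v w l) (hA : Function.Injective A)
    (hnr : NonReductive A) :
    ∃ p p', through A P = {v, w, p, p'} ∧ Concurrent (A u) (A l) (A p) := by
  obtain ⟨p, hp, hpv, hpw, hconc⟩ := h.exists_concurrent hA hnr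
  have hcard : ({v, w, p} : Finset (Fin 10)).card = 3 :=
    card_eq_three.2 ⟨v, w, p, h.rotate.u_ne_v, hpv.symm, hpw.symm, rfl⟩
  have hsub : {v, w, p} ⊆ through A P := by
    simp [insert_subset_iff, h.v_mem_P, h.w_mem_P, hp]
  obtain ⟨p', hp'⟩ : ∃ p', through A P \ {v, w, p} = {p'} := by
    rw [← card_eq_one, card_sdiff_of_subset hsub, card_through, h.mult_P, hcard]
  refine ⟨p, p', ?_, hconc⟩
  rw [← sdiff_union_of_subset hsub, hp', union_comm]
  simp only [insert_union, singleton_union]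

end IsQuadrupleTriangle

/-- The sides of a triangle (`0`, `1`, `2`), a transversal `3` in general position to them, and two
more lines through each vertex, the first of which passes through the intersection of the
transversal and the opposite side. -/
structure IsGrid (B : Fin 10 → Line) : Prop where
  injective : Function.Injective B
  sides : ¬ Concurrent (B 0) (B 1) (B 2)
  transversal₀ : ¬ Concurrent (B 3) (B 1) (B 2)
  transversal₁ : ¬ Concurrent (B 0) (B 3) (B 2)
  transversal₂ : ¬ Concurrent (B 0) (B 1) (B 3)
  vertex₄ : Concurrent (B 1) (B 2) (B 4)
  vertex₅ : Concurrent (B 1) (B 2) (B 5)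
  vertex₆ : Concurrent (B 2) (B 0) (B 6)
  vertex₇ : Concurrent (B 2) (B 0) (B 7)
  vertex₈ : Concurrent (B 0) (B 1) (B 8)
  vertex₉ : Concurrent (B 0) (B 1) (B 9)
  opposite₄ : Concurrent (B 0) (B 3) (B 4)
  opposite₆ : Concurrent (B 1) (B 3) (B 6)
  opposite₈ : Concurrent (B 2) (B 3) (B 8)

theorem IsQuadrupleTriangle.exists_isGrid (h : IsQuadrupleTriangle A P Q R u v w l)
    (hA : Function.Injective A) (hnr : NonReductive A) : ∃ e : Fin 10 ≃ Fin 10, IsGrid (A ∘ e) := by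
  obtain ⟨p, p', hP, hp⟩ := h.exists_through_eq hA hnr
  obtain ⟨q, q', hQ, hq⟩ := h.rotate.exists_through_eq hA hnr
  obtain ⟨r, r', hR, hr⟩ := h.rotate.rotate.exists_through_eq hA hnr
  obtain ⟨hlP, hlQ, hlR⟩ := (h.eq_l_iff l).1 rfl
  let f : Fin 10 → Fin 10 := ![u, v, w, l, p, p', q, q', r, r']
  have hf : Function.Surjective f := by
    intro i
    have hi := h.eq_l_iff i
    simp only [hP, hQ, hR, mem_insert, mem_singleton] at hi
    simp only [f, ← Set.mem_range, range_cons, range_empty, Set.mem_union, Set.mem_singleton_iff,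
      Set.mem_empty_iff_false]
    tauto
  have not_concurrent {i j k : Fin 10} {X : Plane} (hij : i ≠ j) (hi : i ∈ through A X)
      (hj : j ∈ through A X) (hk : k ∉ through A X) : ¬ Concurrent (A i) (A j) (A k) :=
    fun hc => hk (mem_through_of_concurrent hA hij hi hj hc)
  have pencil {X : Plane} {i j k k' : Fin 10} (hX : through A X = {i, j, k, k'}) :
      Concurrent (A i) (A j) (A k) ∧ Concurrent (A i) (A j) (A k') := by
    constructor <;> apply concurrent_of_mem_through (P := X) <;> simp [hX]
  exact ⟨.ofBijective f (Finite.surjective_iff_bijective.1 hf), hA.comp (Equiv.injective _),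
    not_concurrent h.u_ne_v h.u_mem_R h.v_mem_R h.w_notMem,
    fun hc => not_concurrent h.rotate.u_ne_v h.v_mem_P h.w_mem_P hlP hc.rotate,
    fun hc => not_concurrent h.rotate.rotate.u_ne_v h.w_mem_Q h.u_mem_Q hlQ hc.rotate.rotate,
    not_concurrent h.u_ne_v h.u_mem_R h.v_mem_R hlR, (pencil hP).1, (pencil hP).2,
    (pencil hQ).1, (pencil hQ).2, (pencil hR).1, (pencil hR).2, hp, hq, hr⟩

end Triangle

section GridCoordinates

variable {B : Fin 10 → Line} {a b c : ℂ}

/-- Homogeneous coordinates of a grid: the triangle and the transversal `3` form the standard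
projective frame, which leaves one parameter for the second additional line at each vertex. -/
def gridVec (a b c : ℂ) : Fin 10 → Fin 3 → ℂ :=
  ![![1, 0, 0], ![0, 1, 0], ![0, 0, 1], ![1, 1, 1], ![0, 1, 1], ![0, 1, a], ![1, 0, 1],
    ![b, 0, 1], ![1, 1, 0], ![1, c, 0]]

theorem IsGrid.exists_hasCoordinates (h : IsGrid B) :
    ∃ a b c, HasCoordinates B (gridVec a b c) := by
  obtain ⟨g, h₀, h₁, h₂, h₃⟩ :=
    exists_eq_smul_projective_frame h.sides h.transversal₀ h.transversal₁ h.transversal₂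
  have ne {i j : Fin 10} (hij : i ≠ j := by decide) : B i ≠ B j := h.injective.ne hij
  obtain ⟨x, _, h₄⟩ := exists_eq_smul_add_smul h₁ h₂ ne h.vertex₄ ne
  obtain ⟨a, _, h₅⟩ := exists_eq_smul_add_smul h₁ h₂ ne h.vertex₅ ne
  obtain ⟨y, _, h₆⟩ := exists_eq_smul_add_smul h₂ h₀ ne h.vertex₆ ne
  obtain ⟨b, _, h₇⟩ := exists_eq_smul_add_smul h₂ h₀ ne h.vertex₇ ne
  obtain ⟨z, _, h₈⟩ := exists_eq_smul_add_smul h₀ h₁ ne h.vertex₈ ne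
  obtain ⟨c, _, h₉⟩ := exists_eq_smul_add_smul h₀ h₁ ne h.vertex₉ ne
  have hx : x = 1 := by
    have := h.opposite₄
    rw [h₀, h₃, h₄, concurrent_smul_iff, concurrent_mk_iff] at this
    simpa [det_fin_three, sub_eq_zero] using this
  have hy : 1 = y := by
    have := h.opposite₆
    rw [h₁, h₃, h₆, concurrent_smul_iff, concurrent_mk_iff] at this
    simpa [det_fin_three, neg_add_eq_zero] using this
  have hz : z = 1 := by
    have := h.opposite₈
    rw [h₂, h₃, h₈, concurrent_smul_iff, concurrent_mk_iff] at this
    simpa [det_fin_three, sub_eq_zero] using this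
  subst hx hy hz
  refine ⟨a, b, c, g, fun i => ?_⟩
  fin_cases i
  exacts [⟨_, h₀⟩, ⟨_, h₁⟩, ⟨_, h₂⟩, ⟨_, h₃⟩,
    ⟨by simp [gridVec], by simpa [gridVec] using h₄⟩,
    ⟨by simp [gridVec], by simpa [gridVec] using h₅⟩,
    ⟨by simp [gridVec], by simpa [gridVec] using h₆⟩,
    ⟨by simp [gridVec], by simpa [gridVec] using h₇⟩,
    ⟨by simp [gridVec], by simpa [gridVec] using h₈⟩,
    ⟨by simp [gridVec], by simpa [gridVec] using h₉⟩]

/-- The relabelling of a grid that rotates the triangle. -/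
def gridRotation : Fin 10 ≃ Fin 10 where
  toFun := ![1, 2, 0, 3, 6, 7, 8, 9, 4, 5]
  invFun := ![2, 0, 1, 3, 8, 9, 4, 5, 6, 7]
  left_inv := by decide
  right_inv := by decide

theorem HasCoordinates.gridRotation (h : HasCoordinates B (gridVec a b c)) :
    HasCoordinates (B ∘ gridRotation) (gridVec b c a) := by
  have hdet : (of ![![0, 0, 1], ![1, 0, 0], ![0, 1, 0]] : Matrix _ _ ℂ).det ≠ 0 := by
    simp [det_fin_three]
  refine (h.comp LineArr.gridRotation).of_mulVec_eq (GeneralLinearGroup.mkOfDetNeZero _ hdet)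
    fun i => ?_
  ext j
  fin_cases i <;> fin_cases j <;>
    simp [gridVec, LineArr.gridRotation, GeneralLinearGroup.mkOfDetNeZero, mulVec, dotProduct,
      Fin.sum_univ_three]

/-- An injective family of lines with third points, in the coordinates of a grid. -/
structure IsGridWithParams (B : Fin 10 → Line) (a b c : ℂ) : Prop where
  hasCoordinates : HasCoordinates B (gridVec a b c)
  injective : Function.Injective B
  hasThirdPoints : HasThirdPoints B

/-- The lines of a grid that do not pass through the intersection of `1` and `2`. -/
def offVertex : Fin 6 → Fin 10 := ![0, 3, 6, 7, 8, 9]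

/-- The line `![0, 1, q]` meets the lines `offVertex m` of a grid in the points `![s, -q, 1]`,
and these are the values of `s`. -/
noncomputable def gridSlope (b c q : ℂ) : Fin 6 → ℂ := ![0, q - 1, -1, -b⁻¹, q, q * c]

theorem gridVec_offVertex_zero_ne (hb : b ≠ 0) (m : Fin 6) : gridVec a b c (offVertex m) 0 ≠ 0 := by
  fin_cases m <;> simp [offVertex, gridVec, hb]

theorem gridSlope_mul (hb : b ≠ 0) (q : ℂ) (m : Fin 6) :
    gridSlope b c q m * gridVec a b c (offVertex m) 0 =
      q * gridVec a b c (offVertex m) 1 - gridVec a b c (offVertex m) 2 := by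
  fin_cases m <;> simp [offVertex, gridVec, gridSlope, hb]

namespace HasCoordinates

variable {i : Fin 10} {q : ℂ}

theorem concurrent_iff_gridSlope_eq (h : HasCoordinates B (gridVec a b c)) (hb : b ≠ 0)
    (hi : gridVec a b c i = ![0, 1, q]) (m m' : Fin 6) :
    Concurrent (B i) (B (offVertex m)) (B (offVertex m')) ↔
      gridSlope b c q m = gridSlope b c q m' := by
  have det_eq : det (of ![![0, 1, q], gridVec a b c (offVertex m), gridVec a b c (offVertex m')]) =
      gridVec a b c (offVertex m) 0 * gridVec a b c (offVertex m') 0 *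
        (gridSlope b c q m' - gridSlope b c q m) := by
    simp only [det_fin_three, of_apply, Matrix.cons_val]
    linear_combination gridVec a b c (offVertex m') 0 * gridSlope_mul (a := a) (c := c) hb q m -
      gridVec a b c (offVertex m) 0 * gridSlope_mul (a := a) (c := c) hb q m'
  rw [h.concurrent_iff, hi, det_eq, mul_eq_zero, or_iff_right (mul_ne_zero
    (gridVec_offVertex_zero_ne hb m) (gridVec_offVertex_zero_ne hb m')), sub_eq_zero, eq_comm]

theorem exists_offVertex_eq (h : HasCoordinates B (gridVec a b c))
    (hi : gridVec a b c i = ![0, 1, q]) {x : Fin 10} (hx : ¬ Concurrent (B i) (B 1) (B x)) :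
    ∃ m, offVertex m = x := by
  have hx₀ : gridVec a b c x 0 ≠ 0 := by
    intro hx₀
    rw [h.concurrent_iff, hi, show gridVec a b c 1 = ![0, 1, 0] from rfl] at hx
    exact hx (by simp [det_fin_three, hx₀])
  revert hx₀
  fin_cases x <;> simp [gridVec, offVertex, Fin.exists_fin_succ]

end HasCoordinates

namespace IsGridWithParams

theorem rotate (h : IsGridWithParams B a b c) : IsGridWithParams (B ∘ gridRotation) b c a where
  hasCoordinates := h.hasCoordinates.gridRotation
  injective := h.injective.comp gridRotation.injective
  hasThirdPoints := h.hasThirdPoints.comp gridRotation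

theorem ne_zero (h : IsGridWithParams B a b c) : a ≠ 0 := by
  rintro rfl
  exact h.injective.ne (by decide : (5 : Fin 10) ≠ 1)
    ((h.hasCoordinates.eq_iff _ _).2 (by simp [gridVec]))

theorem ne_one (h : IsGridWithParams B a b c) : a ≠ 1 := by
  rintro rfl
  exact h.injective.ne (by decide : (5 : Fin 10) ≠ 4)
    ((h.hasCoordinates.eq_iff _ _).2 (by simp [gridVec]))

theorem exists_gridSlope_eq (h : IsGridWithParams B a b c) {i : Fin 10} {q : ℂ}
    (hi : gridVec a b c i = ![0, 1, q]) (hq : q ≠ 0) (j : Fin 6) :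
    ∃ x y, x < y ∧ gridSlope b c q x = gridSlope b c q y ∧
      gridSlope b c q x ≠ gridSlope b c q j := by
  have hb := h.rotate.ne_zero
  have hcoord := h.hasCoordinates
  have one_ne : 1 ≠ i := by
    rintro rfl
    simp [gridVec, hq.symm] at hi
  have offVertex_ne : offVertex j ≠ i := by
    rintro rfl
    exact gridVec_offVertex_zero_ne hb j (congrFun hi 0)
  obtain ⟨x, y, hxy, hconc, hx, hy, hxj, hyj⟩ :=
    h.hasThirdPoints i 1 (offVertex j) one_ne offVertex_ne
  obtain ⟨m, rfl⟩ := hcoord.exists_offVertex_eq hi hx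
  obtain ⟨m', rfl⟩ := hcoord.exists_offVertex_eq hi hy
  rw [hcoord.concurrent_iff_gridSlope_eq hb hi] at hconc hxj hyj
  obtain hlt | hlt := lt_or_gt_of_ne (ne_of_apply_ne offVertex hxy)
  · exact ⟨m, m', hlt, hconc, Ne.symm hxj⟩
  · exact ⟨m', m, hlt, hconc.symm, Ne.symm hyj⟩

theorem eq_neg_one_or_eq_neg_one_or_mul_eq_neg_one (h : IsGridWithParams B a b c) :
    c = -1 ∨ b = -1 ∨ b * c = -1 := by
  have hb := h.rotate.ne_zero
  have hb' := h.rotate.ne_one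
  have hc' := h.rotate.rotate.ne_one
  -- The slopes are `0, 0, -1, -b⁻¹, 1, c`: two nonzero ones agree only in one of the three cases,
  -- the other coincidences being excluded by `b ≠ 1` and `c ≠ 1`.
  obtain ⟨x, y, hxy, heq, hne⟩ := h.exists_gridSlope_eq (i := 4) rfl one_ne_zero 0
  fin_cases x <;> fin_cases y <;> simp [gridSlope] at hxy heq hne <;> grind

theorem eq_neg_one_or_mul_second_eq (h : IsGridWithParams B a b c) :
    a = -1 ∨ a * b = -1 ∨ a * b = b - 1 := by
  have ha := h.ne_zero
  have ha' := h.ne_one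
  have hb := h.rotate.ne_zero
  have hb' := h.rotate.ne_one
  obtain ⟨x, y, hxy, heq, hne⟩ := h.exists_gridSlope_eq (i := 5) rfl ha 5
  fin_cases x <;> fin_cases y <;> simp [gridSlope] at hxy heq hne <;> grind

theorem eq_neg_one_or_mul_third_eq (h : IsGridWithParams B a b c) :
    a = -1 ∨ a * c = -1 ∨ a * c = a - 1 := by
  have ha := h.ne_zero
  have ha' := h.ne_one
  have hc := h.rotate.rotate.ne_zero
  have hc' := h.rotate.rotate.ne_one
  obtain ⟨x, y, hxy, heq, hne⟩ := h.exists_gridSlope_eq (i := 5) rfl ha 3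
  fin_cases x <;> fin_cases y <;> simp [gridSlope] at hxy heq hne <;> grind

theorem mul_eq_neg_one_or (h : IsGridWithParams B a b c) :
    a * b = -1 ∨ a = -1 ∧ b = -1 ∨ a = -1 ∧ 2 * b = 1 ∨ a = 2 ∧ b = -1 := by
  have hab := h.rotate.rotate.eq_neg_one_or_eq_neg_one_or_mul_eq_neg_one
  have hab' := h.eq_neg_one_or_mul_second_eq
  have hba := h.rotate.eq_neg_one_or_mul_third_eq
  grind

theorem params_eq (h : IsGridWithParams B a b c) : b = a ∧ c = a ∧ (a = -1 ∨ a * a = -1) := by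
  have hab := h.mul_eq_neg_one_or
  have hbc := h.rotate.mul_eq_neg_one_or
  have hca := h.rotate.rotate.mul_eq_neg_one_or
  have ha := h.ne_one
  have hb := h.rotate.ne_one
  have hc := h.rotate.rotate.ne_one
  grind

end IsGridWithParams

end GridCoordinates

section GridModuli

variable {A : Fin 10 → Line} {e : Fin 10 ≃ Fin 10}

theorem SameLattice.isGrid {B : Fin 10 → Line} (h : SameLattice B A)
    (he : IsGrid (A ∘ e)) : IsGrid (B ∘ e) := by
  have hA : Function.Injective A := by simpa using he.injective
  have hconc (i j k : Fin 10) := h.concurrent_iff (e i) (e j) (e k)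
  constructor
  · exact (h.injective hA).comp e.injective
  all_goals simp only [Function.comp_apply, hconc]
  exacts [he.sides, he.transversal₀, he.transversal₁, he.transversal₂, he.vertex₄, he.vertex₅,
    he.vertex₆, he.vertex₇, he.vertex₈, he.vertex₉, he.opposite₄, he.opposite₆, he.opposite₈]

theorem IsGrid.exists_param (he : IsGrid (A ∘ e)) (hA : HasThirdPoints A)
    (B : Realization A) :
    ∃ a, (a = -1 ∨ a * a = -1) ∧ HasCoordinates B.1 (gridVec a a a ∘ e.symm) ∧
      (a = -1 ↔ Concurrent (A (e 5)) (A (e 6)) (A (e 8))) := by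
  have hB := B.2.isGrid he
  obtain ⟨a, b, c, hcoord⟩ := hB.exists_hasCoordinates
  obtain ⟨hba, hca, ha⟩ :=
    IsGridWithParams.params_eq ⟨hcoord, hB.injective, (B.2.hasThirdPoints hA).comp e⟩
  rw [hba, hca] at hcoord
  refine ⟨a, ha, by simpa [Function.comp_def] using hcoord.comp e.symm, ?_⟩
  rw [← B.2.concurrent_iff]
  refine Iff.trans ?_ (hcoord.concurrent_iff 5 6 8).symm
  simp [gridVec, det_fin_three, eq_neg_iff_add_eq_zero, add_comm]

theorem star_gridVec (a b c : ℂ) (i : Fin 10) :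
    star (gridVec a b c i) = gridVec (star a) (star b) (star c) i := by
  ext j
  fin_cases i <;> fin_cases j <;> simp [gridVec]

theorem irreducibleSpace_moduli_or_conjModuli_of_isGrid (he : IsGrid (A ∘ e))
    (hA : HasThirdPoints A) : IrreducibleSpace (Moduli A) ∨ IrreducibleSpace (ConjModuli A) := by
  by_cases hconc : Concurrent (A (e 5)) (A (e 6)) (A (e 8))
  · have hcoord (B : Realization A) : HasCoordinates B.1 (gridVec (-1) (-1) (-1) ∘ e.symm) := by
      obtain ⟨a, -, hB, ha⟩ := he.exists_param hA B
      exact ha.2 hconc ▸ hB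
    have := subsingleton_moduli_of_hasCoordinates hcoord
    exact .inl ⟨nonempty_moduli A⟩
  · have hcoord (B : Realization A) : HasCoordinates B.1 (gridVec .I .I .I ∘ e.symm) ∨
        HasCoordinates B.1 fun i => star ((gridVec .I .I .I ∘ e.symm) i) := by
      obtain ⟨a, ha, hB, ha'⟩ := he.exists_param hA B
      have haI : a * a = Complex.I * Complex.I := by
        rw [Complex.I_mul_I]
        exact ha.resolve_left (mt ha'.1 hconc)
      obtain rfl | rfl := mul_self_eq_mul_self_iff.1 haI
      · exact .inl hB
      · exact .inr (by simpa [Function.comp_def, star_gridVec] using hB)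
    have := subsingleton_conjModuli_of_hasCoordinates hcoord
    exact .inr ⟨nonempty_conjModuli A⟩

end GridModuli

end LineArr

theorem mainTheorem5 (A : Fin 10 → LineArr.Line) (hdistinct : Function.Injective A)
    (hnr : LineArr.NonReductive A) (h4 : LineArr.numPoints A 4 = 3)
    (h5 : ∀ r : ℕ, 5 ≤ r → LineArr.numPoints A r = 0) :
    IrreducibleSpace (LineArr.Moduli A) ∨ IrreducibleSpace (LineArr.ConjModuli A) := by
  obtain ⟨P, Q, R, hPQ, hPR, hQR, hS⟩ := Set.encard_eq_three.1 h4
  obtain ⟨hP, hQ, hR⟩ : LineArr.mult A P = 4 ∧ LineArr.mult A Q = 4 ∧ LineArr.mult A R = 4 := by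
    simpa [Set.insert_subset_iff] using hS.ge
  by_cases hl : ∃ l ∈ LineArr.through A P, l ∈ LineArr.through A Q ∧ l ∈ LineArr.through A R
  · obtain ⟨l, hlP, hlQ, hlR⟩ := hl
    exact .inl (LineArr.irreducibleSpace_moduli_of_common_line hdistinct hP hQ hR hPQ hPR hQR
      hlP hlQ hlR)
  · push Not at hl
    obtain ⟨u, v, w, l, htri⟩ :=
      LineArr.exists_isQuadrupleTriangle hdistinct hnr hP hQ hR hPQ hPR hQR hl
    obtain ⟨e, he⟩ := htri.exists_isGrid hdistinct hnr
    exact LineArr.irreducibleSpace_moduli_or_conjModuli_of_isGrid he (hnr.hasThirdPoints hdistinct)
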